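/- In the Hedge setting with $M$ experts, an algorithm $\mathcal{A}=(A_t)_{t\ge 1}$ is a sequence of measurable maps $A_t:([0,1]^M)^{t-1}\to\mathcal{P}_M$, where $\mathcal{P}_M\subset\mathbf{R}^M$ is the probability simplex; on a sequence of loss vectors $\boldsymbol\ell_t=(\ell_{i,t})_{1\le i\le M}\in[0,1]^M$, $t\ge 1$, it plays $\boldsymbol v_t=A_t(\boldsymbol\ell_1,\dots,\boldsymbol\ell_{t-1})$ at round $t$ and suffers the loss $\sum_{i=1}^M v_{i,t}\ell_{i,t}$. Let $\Delta\in(0,\tfrac14)$, let $M\ge 4$ be an integer and let $T\ge(\log M)/(16\Delta^2)$ be an integer. Then for any algorithm for the Hedge setting with $M$ experts, there exist a distribution of the loss sequence $(\boldsymbol\ell_t)_{t\ge1}$, under which the vectors $\boldsymbol\ell_t$ are i.i.d. over rounds and each $\boldsymbol\ell_t$ has independent Bernoulli ($\{0,1\}$-valued) coordinates, and an expert $i^*\in\{1,\dots,M\}$, such that: - the sub-optimality gap is $\Delta$: for every $t\ge1$, $\mathbb{E}[\ell_{i,t}-\ell_{i^*,t}]\ge\Delta$ for all $i\ne i^*$,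 with equality for some $i\ne i^*$; - the pseudo-regret of the algorithm after $T$ rounds satisfies $$\mathcal{R}_T=\mathbb{E}\Big[\sum_{t=1}^T\sum_{i=1}^M v_{i,t}\ell_{i,t}-\sum_{t=1}^T\ell_{i^*,t}\Big]\ \ge\ \frac{\log M}{256\,\Delta}.$$ -/

import Mathlib

open MeasureTheory ProbabilityTheory

/-- A loss vector in `[0, 1] ^ M`: one loss for each of the `M` experts. -/
abbrev LossVector (M : ℕ) : Type := Fin M → unitInterval

/-- An algorithm for the Hedge setting with `M` experts. Rounds are numbered from `0`, so that at
round `t` the learner has observed exactly `t` loss vectors; it maps them measurably to a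
probability vector on the experts. -/
structure HedgeAlgorithm (M : ℕ) where
  weights : (t : ℕ) → (Fin t → LossVector M) → (Fin M → ℝ)
  weights_mem : ∀ (t : ℕ) (h : Fin t → LossVector M), weights t h ∈ stdSimplex ℝ (Fin M)
  measurable_weights : ∀ t : ℕ, Measurable (weights t)

/-- The probability vector `v_t` played at round `t` on the loss sequence `l`. -/
def HedgeAlgorithm.play {M : ℕ} (A : HedgeAlgorithm M) (l : ℕ → LossVector M) (t : ℕ) :
    Fin M → ℝ :=
  A.weights t (fun s : Fin t => l s)

/-- The loss `∑ i, v_{i,t} * l_{i,t}` of the learner at round `t`. -/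
noncomputable def HedgeAlgorithm.loss {M : ℕ} (A : HedgeAlgorithm M) (l : ℕ → LossVector M)
    (t : ℕ) : ℝ :=
  ∑ i : Fin M, A.play l t i * (l t i : ℝ)

/-- The regret `R_{i,T}` with respect to expert `i` after `T` rounds. -/
noncomputable def HedgeAlgorithm.regret {M : ℕ} (A : HedgeAlgorithm M) (i : Fin M) (T : ℕ)
    (l : ℕ → LossVector M) : ℝ :=
  ∑ t ∈ Finset.range T, A.loss l t - ∑ t ∈ Finset.range T, (l t i : ℝ)

/-- The pseudo-regret `E[R_{iStar,T}]` after `T` rounds when the loss sequence has law `P` and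
`iStar` is the expert with smallest expected loss. -/
noncomputable def HedgeAlgorithm.pseudoRegret {M : ℕ} (A : HedgeAlgorithm M)
    (P : Measure (ℕ → LossVector M)) (iStar : Fin M) (T : ℕ) : ℝ :=
  ∫ l, A.regret iStar T l ∂P

/-- The law of an i.i.d. sequence of loss vectors with common law `ν`. -/
noncomputable def iidLaw {M : ℕ} (ν : Measure (LossVector M)) [IsProbabilityMeasure ν] :
    Measure (ℕ → LossVector M) :=
  Measure.infinitePi (fun _ : ℕ => ν)

/-- The law of a loss vector whose coordinates are independent Bernoulli variables, the `i`-th one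
being `1` with probability `p i` and `0` otherwise. -/
noncomputable def bernoulliLossLaw {M : ℕ} (p : Fin M → unitInterval) : Measure (LossVector M) :=
  Measure.pi (fun i : Fin M => bernoulliMeasure (1 : unitInterval) (0 : unitInterval) (p i))

instance isProbabilityMeasure_bernoulliLossLaw {M : ℕ} (p : Fin M → unitInterval) :
    IsProbabilityMeasure (bernoulliLossLaw p) := by
  unfold bernoulliLossLaw
  infer_instance

/-! Compare `M` environments: in the `k`-th, expert `k` has mean `1/2 - Δ` and all others have mean
`1/2`. Regret there is `Δ` times the expected weight placed off `k`, so it suffices that for some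
`k` the weight on `k` stays bounded away from 1 on average over the early rounds. Let `L` be the
likelihood ratio of environment `k` to fair losses after `t` rounds. The expected weight on `k` is
the fair expectation of `L * w`, and `L * w ≤ M/2 * w + L^2 / (2M)`. Summing over `k`, the fair
weights add up to 1 and each `L^2` has mean `(1 + 4Δ^2)^t`, giving
`sum_integral_play_singleGoodExpert_le`. For `t ≤ log M / (16Δ^2)` this power is at most `3M/4`, so
the average over `k` is at most `7/8`, and some `k` does no worse than the average. -/

open scoped ENNReal NNReal

/-! ### Densities of product measures -/

section ProductMeasures

variable {ι : Type*} [Fintype ι] {E : ι → Type*} [∀ i, MeasurableSpace (E i)]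

/-- A product of measures with densities has the product of the densities as its density. -/
theorem pi_withDensity_eq (μ : (i : ι) → Measure (E i)) [∀ i, IsProbabilityMeasure (μ i)]
    (f : (i : ι) → E i → ℝ≥0∞) (hf : ∀ i, Measurable (f i))
    [∀ i, SigmaFinite ((μ i).withDensity (f i))] :
    Measure.pi (fun i => (μ i).withDensity (f i)) =
      (Measure.pi μ).withDensity (fun x => ∏ i, f i (x i)) := by
  refine Measure.pi_eq fun s hs => ?_
  -- On a box the density is a product of functions of single coordinates, so independence factors
  -- its integral.
  have hind : ∀ i, Measurable ((s i).indicator (f i)) := fun i => (hf i).indicator (hs i)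
  have hprod : (Set.univ.pi s).indicator (fun x : (i : ι) → E i => ∏ i, f i (x i)) =
      fun x => ∏ i, (s i).indicator (f i) (x i) := by
    funext x
    by_cases hx : x ∈ Set.univ.pi s
    · rw [Set.indicator_of_mem hx]
      exact Finset.prod_congr rfl fun i _ => (Set.indicator_of_mem (hx i trivial) _).symm
    · rw [Set.indicator_of_notMem hx]
      obtain ⟨i, hi⟩ : ∃ i, x i ∉ s i := by simpa using hx
      exact (Finset.prod_eq_zero (Finset.mem_univ i) (Set.indicator_of_notMem hi _)).symm
  rw [withDensity_apply _ (MeasurableSet.univ_pi hs),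
    ← lintegral_indicator (MeasurableSet.univ_pi hs), hprod,
    lintegral_prod_eq_prod_lintegral_of_indepFun Finset.univ
      (fun i (x : (i : ι) → E i) => (s i).indicator (f i) (x i))
      (iIndepFun_pi fun i => (hind i).aemeasurable)
      (fun i => (hind i).comp (measurable_pi_apply i))]
  refine Finset.prod_congr rfl fun i _ => ?_
  rw [withDensity_apply _ (hs i), ← lintegral_indicator (hs i)]
  exact (measurePreserving_eval μ i).lintegral_comp (hind i)

end ProductMeasures

/-! ### Likelihood ratio of a single round -/

/-- The density of the Bernoulli law with mean `1 / 2 - Δ` with respect to the fair one. -/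
noncomputable def tiltDensity (Δ : ℝ) (x : unitInterval) : ℝ := 1 + 4 * Δ * (1 / 2 - (x : ℝ))

theorem measurable_tiltDensity (Δ : ℝ) : Measurable (tiltDensity Δ) := by
  unfold tiltDensity; fun_prop

theorem tiltDensity_nonneg {Δ : ℝ} (hΔ : Δ ∈ Set.Ioo (0 : ℝ) (1 / 4)) (x : unitInterval) :
    0 ≤ tiltDensity Δ x := by
  unfold tiltDensity
  nlinarith [hΔ.1, hΔ.2, x.2.1, x.2.2]

theorem bernoulliMeasure_eq_withDensity_tiltDensity {Δ : ℝ}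
    {q h : unitInterval} (hq : (q : ℝ) = 1 / 2 - Δ) (hh : (h : ℝ) = 1 / 2) :
    bernoulliMeasure (1 : unitInterval) (0 : unitInterval) q =
      (bernoulliMeasure (1 : unitInterval) (0 : unitInterval) h).withDensity
        (fun x => ENNReal.ofReal (tiltDensity Δ x)) := by
  have hm : Measurable fun x => ENNReal.ofReal (tiltDensity Δ x) :=
    (measurable_tiltDensity Δ).ennreal_ofReal
  have e1 : ENNReal.ofReal (h : ℝ) * ENNReal.ofReal (tiltDensity Δ 1) = ENNReal.ofReal (q : ℝ) := by
    rw [← ENNReal.ofReal_mul h.2.1, hh, hq]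
    congr 1; simp only [tiltDensity, Set.Icc.coe_one]; ring
  have e0 : ENNReal.ofReal (1 - h : ℝ) * ENNReal.ofReal (tiltDensity Δ 0) =
      ENNReal.ofReal (1 - q : ℝ) := by
    rw [← ENNReal.ofReal_mul (sub_nonneg.2 h.2.2), hh, hq]
    congr 1; simp only [tiltDensity, Set.Icc.coe_zero]; ring
  have key : ∀ (p : unitInterval), bernoulliMeasure (1 : unitInterval) (0 : unitInterval) p =
      ENNReal.ofReal (p : ℝ) • Measure.dirac 1 + ENNReal.ofReal (1 - p : ℝ) • Measure.dirac 0 := by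
    intro p
    rw [bernoulliMeasure_def]
    have h1 : ENNReal.ofReal (p : ℝ) = (unitInterval.toNNReal p : ℝ≥0∞) :=
      ENNReal.ofReal_eq_coe_nnreal p.2.1
    have h0 : ENNReal.ofReal (1 - p : ℝ) =
        (unitInterval.toNNReal (unitInterval.symm p) : ℝ≥0∞) :=
      ENNReal.ofReal_eq_coe_nnreal (sub_nonneg.2 p.2.2)
    rw [h1, h0]
    rfl
  ext s hs
  rw [withDensity_apply _ hs, ← lintegral_indicator hs, key, key, lintegral_add_measure,
    lintegral_smul_measure, lintegral_smul_measure, lintegral_dirac' _ (hm.indicator hs),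
    lintegral_dirac' _ (hm.indicator hs), Measure.add_apply, Measure.smul_apply,
    Measure.smul_apply, Measure.dirac_apply' _ hs, Measure.dirac_apply' _ hs, ← e1, ← e0]
  by_cases h1 : (1 : unitInterval) ∈ s <;> by_cases h0 : (0 : unitInterval) ∈ s <;>
    simp [h1, h0]

theorem integral_tiltDensity_sq (Δ : ℝ) {h : unitInterval} (hh : (h : ℝ) = 1 / 2) :
    ∫ x, tiltDensity Δ x ^ 2 ∂(bernoulliMeasure (1 : unitInterval) (0 : unitInterval) h) =
      1 + 4 * Δ ^ 2 := by
  rw [integral_bernoulliMeasure, hh]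
  simp only [tiltDensity, Set.Icc.coe_one, Set.Icc.coe_zero, smul_eq_mul]
  ring

instance isProbabilityMeasure_iidLaw {M : ℕ} (ν : Measure (LossVector M))
    [IsProbabilityMeasure ν] : IsProbabilityMeasure (iidLaw ν) := by
  unfold iidLaw; infer_instance

/-- The means of the environment in which expert `k` has mean `q` and all others have mean `h`. -/
noncomputable def singleGoodExpert {M : ℕ} (q h : unitInterval) (k : Fin M) :
    Fin M → unitInterval :=
  Function.update (fun _ => h) k q

theorem bernoulliLossLaw_singleGoodExpert {M : ℕ} {Δ : ℝ}
    {q h : unitInterval} (hq : (q : ℝ) = 1 / 2 - Δ) (hh : (h : ℝ) = 1 / 2) (k : Fin M) :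
    bernoulliLossLaw (singleGoodExpert q h k) =
      (bernoulliLossLaw fun _ : Fin M => h).withDensity
        (fun l => ENNReal.ofReal (tiltDensity Δ (l k))) := by
  let f : Fin M → unitInterval → ℝ≥0∞ :=
    fun i x => if i = k then ENNReal.ofReal (tiltDensity Δ x) else 1
  have hf : ∀ i, Measurable (f i) := by
    intro i
    by_cases hi : i = k
    · simpa [f, hi] using (measurable_tiltDensity Δ).ennreal_ofReal
    · simp [f, hi]
  have hcoord : ∀ i, bernoulliMeasure (1 : unitInterval) (0 : unitInterval)
      (singleGoodExpert q h k i) =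
        (bernoulliMeasure (1 : unitInterval) (0 : unitInterval) h).withDensity (f i) := by
    intro i
    by_cases hi : i = k
    · subst hi
      simpa [f, singleGoodExpert] using bernoulliMeasure_eq_withDensity_tiltDensity hq hh
    · have : f i = 1 := by funext x; simp [f, hi]
      rw [this, withDensity_one]
      simp [singleGoodExpert, hi]
  have : ∀ i, SigmaFinite
      ((bernoulliMeasure (1 : unitInterval) (0 : unitInterval) h).withDensity (f i)) := by
    intro i
    rw [← hcoord i]
    infer_instance
  unfold bernoulliLossLaw
  simp_rw [hcoord]
  rw [pi_withDensity_eq _ f hf]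
  congr 1
  funext l
  simp [f, Finset.prod_ite_eq']

/-! ### Marginals of the i.i.d. loss sequence -/

theorem integral_comp_prefix {M : ℕ} (ν : Measure (LossVector M)) [IsProbabilityMeasure ν]
    (t : ℕ) {f : (Fin t → LossVector M) → ℝ} (hf : Measurable f) :
    ∫ l, f (fun s : Fin t => l s) ∂(iidLaw ν) = ∫ x, f x ∂(Measure.pi fun _ : Fin t => ν) := by
  have h := Measure.map_infinitePi_infinitePi_of_inj (P := fun _ : ℕ => ν)
    (f := fun s : Fin t => (s : ℕ)) Fin.val_injective
  rw [Measure.infinitePi_eq_pi (μ := fun _ : Fin t => ν)] at h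
  rw [← h, integral_map
    (measurable_pi_lambda _ fun s : Fin t => measurable_pi_apply (s : ℕ)).aemeasurable hf.aestronglyMeasurable]
  rfl

theorem integral_loss_iidLaw {M : ℕ} (p : Fin M → unitInterval) (t : ℕ) (i : Fin M) :
    ∫ l, (l t i : ℝ) ∂(iidLaw (bernoulliLossLaw p)) = p i := by
  have h1 := (measurePreserving_eval_infinitePi (fun _ : ℕ => bernoulliLossLaw p) t)
  have h2 := measurePreserving_eval
    (fun i : Fin M => bernoulliMeasure (1 : unitInterval) (0 : unitInterval) (p i)) i
  have h3 := (h2.comp h1).map_eq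
  have : ∫ l, (l t i : ℝ) ∂(iidLaw (bernoulliLossLaw p)) =
      ∫ x : unitInterval, (x : ℝ) ∂(bernoulliMeasure (1 : unitInterval) (0 : unitInterval) (p i)) := by
    rw [← h3, integral_map (h2.comp h1).measurable.aemeasurable
      (measurable_subtype_coe.aestronglyMeasurable)]
    rfl
  rw [this, integral_bernoulliMeasure]
  simp

theorem measurable_loss_apply {M : ℕ} (t : ℕ) (i : Fin M) :
    Measurable fun l : ℕ → LossVector M => (l t i : ℝ) :=
  measurable_subtype_coe.comp (by fun_prop)

theorem integrable_loss {M : ℕ} {P : Measure (ℕ → LossVector M)} [IsProbabilityMeasure P]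
    (t : ℕ) (i : Fin M) : Integrable (fun l : ℕ → LossVector M => (l t i : ℝ)) P := by
  refine Integrable.of_bound (C := 1) (measurable_loss_apply t i).aestronglyMeasurable
    (ae_of_all _ fun l => ?_)
  rw [Real.norm_of_nonneg (l t i).2.1]
  exact (l t i).2.2

/-! ### Weights and pseudo-regret -/

namespace HedgeAlgorithm

variable {M : ℕ} (A : HedgeAlgorithm M)

theorem weights_nonneg (t : ℕ) (x : Fin t → LossVector M) (i : Fin M) : 0 ≤ A.weights t x i :=
  (A.weights_mem t x).1 i

theorem sum_weights (t : ℕ) (x : Fin t → LossVector M) : ∑ i, A.weights t x i = 1 :=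
  (A.weights_mem t x).2

theorem weights_le_one (t : ℕ) (x : Fin t → LossVector M) (i : Fin M) : A.weights t x i ≤ 1 := by
  rw [← A.sum_weights t x]
  exact Finset.single_le_sum (fun j _ => A.weights_nonneg t x j) (Finset.mem_univ i)

theorem measurable_weights_apply (t : ℕ) (i : Fin M) : Measurable fun x => A.weights t x i :=
  (measurable_pi_apply i).comp (A.measurable_weights t)

theorem measurable_play_apply (t : ℕ) (i : Fin M) : Measurable fun l => A.play l t i :=
  (A.measurable_weights_apply t i).comp (by fun_prop)

theorem integrable_weights {t : ℕ} (P : Measure (Fin t → LossVector M)) [IsProbabilityMeasure P]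
    (i : Fin M) : Integrable (fun x => A.weights t x i) P := by
  refine Integrable.of_bound (C := 1) (A.measurable_weights_apply t i).aestronglyMeasurable
    (ae_of_all _ fun x => ?_)
  rw [Real.norm_of_nonneg (A.weights_nonneg t x i)]
  exact A.weights_le_one t x i

theorem integrable_play (P : Measure (ℕ → LossVector M)) [IsProbabilityMeasure P]
    (t : ℕ) (i : Fin M) : Integrable (fun l => A.play l t i) P := by
  refine Integrable.of_bound (C := 1) (A.measurable_play_apply t i).aestronglyMeasurable
    (ae_of_all _ fun l => ?_)
  exact (Real.norm_of_nonneg (A.weights_nonneg t _ i)).trans_le (A.weights_le_one t _ i)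

theorem integrable_play_mul_loss (P : Measure (ℕ → LossVector M)) [IsProbabilityMeasure P]
    (t : ℕ) (i : Fin M) : Integrable (fun l => A.play l t i * (l t i : ℝ)) P := by
  refine (A.integrable_play P t i).mul_bdd (c := 1)
    (measurable_loss_apply t i).aestronglyMeasurable (ae_of_all _ fun l => ?_)
  rw [Real.norm_of_nonneg (l t i).2.1]
  exact (l t i).2.2

/-- The weights at round `t` depend only on rounds before `t`, which are independent of round `t`.
-/
theorem indepFun_play_loss (ν : Measure (LossVector M)) [IsProbabilityMeasure ν]
    (t : ℕ) (i : Fin M) :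
    IndepFun (fun l => A.play l t i) (fun l : ℕ → LossVector M => (l t i : ℝ)) (iidLaw ν) := by
  have hind : iIndepFun (fun (s : ℕ) (l : ℕ → LossVector M) => l s) (iidLaw ν) :=
    iIndepFun_infinitePi (P := fun _ : ℕ => ν) (X := fun _ x => x) fun _ => measurable_id
  have h := hind.indepFun_finset (Finset.range t) {t} (by simp) (fun s => measurable_pi_apply s)
  exact h.comp
    (φ := fun x : Finset.range t → LossVector M =>
      A.weights t (fun s : Fin t => x ⟨s, Finset.mem_range.2 s.2⟩) i)
    (ψ := fun x : ({t} : Finset ℕ) → LossVector M => (x ⟨t, Finset.mem_singleton_self t⟩ i : ℝ))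
    ((A.measurable_weights_apply t i).comp (by fun_prop)) (by fun_prop)

theorem integral_play_mul_loss (p : Fin M → unitInterval) (t : ℕ) (i : Fin M) :
    ∫ l, A.play l t i * (l t i : ℝ) ∂(iidLaw (bernoulliLossLaw p)) =
      (∫ l, A.play l t i ∂(iidLaw (bernoulliLossLaw p))) * p i := by
  rw [(A.indepFun_play_loss (bernoulliLossLaw p) t i).integral_fun_mul_eq_mul_integral
    (A.measurable_play_apply t i).aestronglyMeasurable
    (measurable_loss_apply t i).aestronglyMeasurable, integral_loss_iidLaw]

theorem sum_integral_play (P : Measure (ℕ → LossVector M)) [IsProbabilityMeasure P] (t : ℕ) :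
    ∑ i, ∫ l, A.play l t i ∂P = 1 := by
  rw [← integral_finsetSum _ fun i _ => A.integrable_play P t i]
  simp [play, sum_weights]

theorem integral_play_le_one (P : Measure (ℕ → LossVector M)) [IsProbabilityMeasure P] (t : ℕ)
    (i : Fin M) : ∫ l, A.play l t i ∂P ≤ 1 := by
  rw [← A.sum_integral_play P t]
  exact Finset.single_le_sum (f := fun i => ∫ l, A.play l t i ∂P)
    (fun j _ => integral_nonneg fun l => A.weights_nonneg t _ j) (Finset.mem_univ i)

/-- The pseudo-regret is the expected cumulative gap of the experts played. -/
theorem pseudoRegret_iidLaw (p : Fin M → unitInterval) (k : Fin M) (T : ℕ) :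
    A.pseudoRegret (iidLaw (bernoulliLossLaw p)) k T =
      ∑ t ∈ Finset.range T, ∑ i,
        (∫ l, A.play l t i ∂(iidLaw (bernoulliLossLaw p))) * ((p i : ℝ) - p k) := by
  have hloss : ∀ t, Integrable (fun l => A.loss l t) (iidLaw (bernoulliLossLaw p)) := fun t =>
    integrable_finsetSum _ fun i _ => A.integrable_play_mul_loss _ t i
  unfold pseudoRegret regret
  rw [integral_sub (integrable_finsetSum _ fun t _ => hloss t)
    (integrable_finsetSum _ fun t _ => integrable_loss t k),
    integral_finsetSum _ fun t _ => hloss t,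
    integral_finsetSum _ fun t _ => integrable_loss t k, ← Finset.sum_sub_distrib]
  refine Finset.sum_congr rfl fun t _ => ?_
  unfold loss
  rw [integral_finsetSum _ fun i _ => A.integrable_play_mul_loss _ t i]
  simp_rw [integral_play_mul_loss, integral_loss_iidLaw, mul_sub]
  rw [Finset.sum_sub_distrib, ← Finset.sum_mul, A.sum_integral_play, one_mul]

theorem pseudoRegret_singleGoodExpert {Δ : ℝ} {q h : unitInterval} (hqh : (h : ℝ) - q = Δ)
    (k : Fin M) (T : ℕ) :
    A.pseudoRegret (iidLaw (bernoulliLossLaw (singleGoodExpert q h k))) k T =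
      ∑ t ∈ Finset.range T,
        Δ * (1 - ∫ l, A.play l t k ∂(iidLaw (bernoulliLossLaw (singleGoodExpert q h k)))) := by
  rw [pseudoRegret_iidLaw]
  refine Finset.sum_congr rfl fun t _ => ?_
  rw [← A.sum_integral_play (iidLaw (bernoulliLossLaw (singleGoodExpert q h k))) t,
    ← Finset.add_sum_erase _ _ (Finset.mem_univ k), ← Finset.add_sum_erase _ _ (Finset.mem_univ k),
    sub_self, mul_zero, zero_add, add_sub_cancel_left, Finset.mul_sum]
  refine Finset.sum_congr rfl fun i hi => ?_
  have hik : i ≠ k := Finset.ne_of_mem_erase hi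
  rw [show singleGoodExpert q h k i = h by simp [singleGoodExpert, hik],
    show singleGoodExpert q h k k = q by simp [singleGoodExpert], hqh, mul_comm]

/-! ### Change of measure to fair losses -/

/-- The expected weights in the environment favouring `k`, as an expectation under fair losses. -/
theorem integral_play_singleGoodExpert {Δ : ℝ} (hΔ : Δ ∈ Set.Ioo (0 : ℝ) (1 / 4))
    {q h : unitInterval} (hq : (q : ℝ) = 1 / 2 - Δ) (hh : (h : ℝ) = 1 / 2) (k : Fin M) (t : ℕ) :
    ∫ l, A.play l t k ∂(iidLaw (bernoulliLossLaw (singleGoodExpert q h k))) =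
      ∫ x, (∏ s, tiltDensity Δ (x s k)) * A.weights t x k
        ∂(Measure.pi fun _ : Fin t => bernoulliLossLaw fun _ : Fin M => h) := by
  have hdm : Measurable fun l : LossVector M => ENNReal.ofReal (tiltDensity Δ (l k)) :=
    ((measurable_tiltDensity Δ).comp (measurable_pi_apply k)).ennreal_ofReal
  have hν := bernoulliLossLaw_singleGoodExpert (M := M) hq hh k
  have : SigmaFinite ((bernoulliLossLaw fun _ : Fin M => h).withDensity
      (fun l => ENNReal.ofReal (tiltDensity Δ (l k)))) := by
    rw [← hν]; infer_instance
  have hpm : Measurable fun x : Fin t → LossVector M =>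
      ∏ s, ENNReal.ofReal (tiltDensity Δ (x s k)) :=
    Finset.measurable_prod _ fun s _ => hdm.comp (measurable_pi_apply s)
  rw [show (fun l => A.play l t k) = fun l => (fun x => A.weights t x k) fun s : Fin t => l s
    from rfl, integral_comp_prefix _ t (A.measurable_weights_apply t k), hν,
    pi_withDensity_eq _ _ fun _ => hdm,
    integral_withDensity_eq_integral_toReal_smul hpm
      (ae_of_all _ fun x => ENNReal.prod_lt_top fun s _ => ENNReal.ofReal_lt_top)]
  refine integral_congr_ae (ae_of_all _ fun x => ?_)
  simp only [ENNReal.toReal_prod, ENNReal.toReal_ofReal (tiltDensity_nonneg hΔ _), smul_eq_mul]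

theorem integral_prod_tiltDensity_sq (Δ : ℝ) {h : unitInterval} (hh : (h : ℝ) = 1 / 2)
    (k : Fin M) (t : ℕ) :
    ∫ x, (∏ s, tiltDensity Δ (x s k)) ^ 2
        ∂(Measure.pi fun _ : Fin t => bernoulliLossLaw fun _ : Fin M => h) =
      (1 + 4 * Δ ^ 2) ^ t := by
  have h1 := measurePreserving_eval
    (fun _ : Fin M => bernoulliMeasure (1 : unitInterval) (0 : unitInterval) h) k
  simp_rw [← Finset.prod_pow]
  rw [integral_fintype_prod_eq_pow (fun l : LossVector M => tiltDensity Δ (l k) ^ 2),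
    Fintype.card_fin, ← integral_tiltDensity_sq Δ hh, ← h1.map_eq,
    integral_map h1.measurable.aemeasurable
      ((measurable_tiltDensity Δ).pow_const 2).aestronglyMeasurable]
  rfl

theorem integrable_prod_tiltDensity_sq {Δ : ℝ} (h : unitInterval) (k : Fin M) (t : ℕ) :
    Integrable (fun x => (∏ s, tiltDensity Δ (x s k)) ^ 2)
      (Measure.pi fun _ : Fin t => bernoulliLossLaw fun _ : Fin M => h) := by
  simp_rw [← Finset.prod_pow]
  refine Integrable.fintype_prod (f := fun _ (l : LossVector M) => tiltDensity Δ (l k) ^ 2)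
    fun _ => ?_
  exact (measurePreserving_eval (fun _ : Fin M => bernoulliMeasure (1 : unitInterval)
    (0 : unitInterval) h) k).integrable_comp_of_integrable
      (integrable_bernoulliMeasure _ _ _ fun x => tiltDensity Δ x ^ 2)

/-- A weighted AM-GM inequality replaces the likelihood ratio by its second moment; the parameter
`M` balances the two terms after summing over `k`. -/
theorem sum_integral_play_singleGoodExpert_le {Δ : ℝ} (hΔ : Δ ∈ Set.Ioo (0 : ℝ) (1 / 4))
    (hM : 0 < M) {q h : unitInterval} (hq : (q : ℝ) = 1 / 2 - Δ) (hh : (h : ℝ) = 1 / 2) (t : ℕ) :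
    ∑ k, ∫ l, A.play l t k ∂(iidLaw (bernoulliLossLaw (singleGoodExpert q h k))) ≤
      (M + (1 + 4 * Δ ^ 2) ^ t) / 2 := by
  set P := Measure.pi fun _ : Fin t => bernoulliLossLaw fun _ : Fin M => h with hP
  have hM' : (0 : ℝ) < M := by exact_mod_cast hM
  have hw : ∑ k, ∫ x, A.weights t x k ∂P = 1 := by
    rw [← integral_finsetSum _ fun i _ => A.integrable_weights P i]
    simp [sum_weights]
  have hk : ∀ k, ∫ l, A.play l t k ∂(iidLaw (bernoulliLossLaw (singleGoodExpert q h k))) ≤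
      (M : ℝ) / 2 * ∫ x, A.weights t x k ∂P + 1 / (2 * M) * (1 + 4 * Δ ^ 2) ^ t := by
    intro k
    have hi1 := (A.integrable_weights P k).const_mul ((M : ℝ) / 2)
    have hi2 := (integrable_prod_tiltDensity_sq (Δ := Δ) h k t).const_mul (1 / (2 * (M : ℝ)))
    rw [A.integral_play_singleGoodExpert hΔ hq hh, ← integral_prod_tiltDensity_sq Δ hh k t,
      ← integral_const_mul, ← integral_const_mul, ← integral_add hi1 hi2]
    refine integral_mono_of_nonneg (ae_of_all _ fun x => mul_nonneg
      (Finset.prod_nonneg fun s _ => tiltDensity_nonneg hΔ _) (A.weights_nonneg t x k))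
      (hi1.add hi2) (ae_of_all _ fun x => ?_)
    have h0 := A.weights_nonneg t x k
    have h1 := A.weights_le_one t x k
    simp only
    generalize (∏ s, tiltDensity Δ (x s k)) = L
    generalize A.weights t x k = w at h0 h1
    -- Complete the square; the remainder uses `w^2 ≤ w`.
    have e : (M : ℝ) / 2 * w + 1 / (2 * M) * L ^ 2 - L * w =
        1 / (2 * M) * (M * w - L) ^ 2 + M / 2 * (w * (1 - w)) := by
      field_simp; ring
    have : 0 ≤ 1 / (2 * (M : ℝ)) * (M * w - L) ^ 2 + M / 2 * (w * (1 - w)) := by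
      have := mul_nonneg h0 (sub_nonneg.2 h1)
      positivity
    linarith
  refine (Finset.sum_le_sum fun k _ => hk k).trans_eq ?_
  rw [Finset.sum_add_distrib, ← Finset.mul_sum, hw, Finset.sum_const, Finset.card_univ,
    Fintype.card_fin, nsmul_eq_mul]
  field_simp

end HedgeAlgorithm

/-! ### Choice of horizon and conclusion -/

theorem one_add_pow_le_of_le_log {M : ℕ} (hM : 4 ≤ M) {Δ : ℝ} (hΔ : 0 < Δ) {t : ℕ}
    (ht : (t : ℝ) ≤ Real.log M / (16 * Δ ^ 2)) : (1 + 4 * Δ ^ 2) ^ t ≤ 3 / 4 * (M : ℝ) := by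
  have hM' : (4 : ℝ) ≤ M := by exact_mod_cast hM
  have h1 : (1 + 4 * Δ ^ 2) ^ t ≤ Real.exp (Real.log M / 4) := by
    calc (1 + 4 * Δ ^ 2) ^ t ≤ Real.exp (4 * Δ ^ 2) ^ t := by
          gcongr; linarith [Real.add_one_le_exp (4 * Δ ^ 2)]
      _ = Real.exp (t * (4 * Δ ^ 2)) := (Real.exp_nat_mul _ _).symm
      _ ≤ _ := by
          rw [le_div_iff₀ (by positivity)] at ht
          gcongr
          linarith
  have h4 : Real.exp (Real.log M / 4) ^ 4 = M := by
    rw [← Real.exp_nat_mul, Nat.cast_ofNat, mul_div_cancel₀ _ (by norm_num : (4 : ℝ) ≠ 0),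
      Real.exp_log (by linarith)]
  refine h1.trans ?_
  set y := Real.exp (Real.log M / 4)
  have hy : 0 < y := Real.exp_pos _
  -- Here `y^4 = M ≥ 4 > (6/5)^4`, and `(6/5)^3 ≥ 4/3` then gives `y ≤ 3/4 * y^4`.
  have hy' : 6 / 5 ≤ y := by
    by_contra! hlt
    have : y ^ 4 ≤ (6 / 5) ^ 4 := by gcongr
    norm_num at this
    linarith
  rw [← h4]
  have : (6 / 5 : ℝ) ^ 3 ≤ y ^ 3 := by gcongr
  norm_num at this
  nlinarith

theorem proposition2 (Δ : ℝ) (hΔ : Δ ∈ Set.Ioo (0 : ℝ) (1 / 4)) (M : ℕ) (hM : 4 ≤ M)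
    (T : ℕ) (hT : Real.log (M : ℝ) / (16 * Δ ^ 2) ≤ (T : ℝ)) (A : HedgeAlgorithm M) :
    ∃ (p : Fin M → unitInterval) (iStar : Fin M),
      (∀ t : ℕ, ∀ i : Fin M, i ≠ iStar →
        Δ ≤ ∫ l, ((l t i : ℝ) - (l t iStar : ℝ)) ∂(iidLaw (bernoulliLossLaw p))) ∧
      (∀ t : ℕ, ∃ i : Fin M, i ≠ iStar ∧
        ∫ l, ((l t i : ℝ) - (l t iStar : ℝ)) ∂(iidLaw (bernoulliLossLaw p)) = Δ) ∧
      Real.log (M : ℝ) / (256 * Δ) ≤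
        A.pseudoRegret (iidLaw (bernoulliLossLaw p)) iStar T := by
  have hΔ0 : 0 < Δ := hΔ.1
  have hM' : (4 : ℝ) ≤ M := by exact_mod_cast hM
  let q : unitInterval := ⟨1 / 2 - Δ, by linarith [hΔ.2], by linarith⟩
  let h : unitInterval := ⟨1 / 2, by norm_num, by norm_num⟩
  have hq : (q : ℝ) = 1 / 2 - Δ := rfl
  have hh : (h : ℝ) = 1 / 2 := rfl
  have hqh : (h : ℝ) - q = Δ := by rw [hq, hh]; ring
  have hgap : ∀ (k : Fin M) (t : ℕ) (i : Fin M), i ≠ k →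
      ∫ l, ((l t i : ℝ) - (l t k : ℝ)) ∂(iidLaw (bernoulliLossLaw (singleGoodExpert q h k))) =
        Δ := by
    intro k t i hik
    rw [integral_sub (integrable_loss t i) (integrable_loss t k), integral_loss_iidLaw,
      integral_loss_iidLaw, show singleGoodExpert q h k i = h by simp [singleGoodExpert, hik],
      show singleGoodExpert q h k k = q by simp [singleGoodExpert], hqh]
  set N : ℝ := Real.log M / (16 * Δ ^ 2) with hN
  have hlog : 1 < Real.log M := by
    rw [Real.lt_log_iff_exp_lt (by linarith)]
    linarith [Real.exp_one_lt_d9]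
  -- Since `log M > 1` and `16Δ^2 < 1`; this makes the floor `n` positive, hence `N < n + 1 ≤ 2n`.
  have hN1 : 1 ≤ N := by
    rw [hN, le_div_iff₀ (by positivity)]
    nlinarith [hΔ.2]
  set n : ℕ := ⌊N⌋₊ with hn
  have hnN : (n : ℝ) ≤ N := Nat.floor_le (by linarith)
  have hn1 : (1 : ℝ) ≤ n := by exact_mod_cast Nat.floor_pos.2 hN1
  have hNn : N < n + 1 := Nat.lt_floor_add_one N
  have hnT : n ≤ T := by exact_mod_cast hnN.trans hT
  let a : Fin M → ℕ → ℝ := fun k t =>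
    ∫ l, A.play l t k ∂(iidLaw (bernoulliLossLaw (singleGoodExpert q h k)))
  have ha1 : ∀ k t, a k t ≤ 1 := fun k t => A.integral_play_le_one _ t k
  -- `7/8 = (1 + 3/4) / 2`.
  have hsum : ∑ k, ∑ t ∈ Finset.range n, a k t ≤ ∑ _k : Fin M, 7 / 8 * (n : ℝ) := by
    rw [Finset.sum_comm]
    calc ∑ t ∈ Finset.range n, ∑ k, a k t ≤ ∑ t ∈ Finset.range n, 7 / 8 * (M : ℝ) := by
          refine Finset.sum_le_sum fun t ht => ?_
          have htN : (t : ℝ) ≤ N := (by exact_mod_cast (Finset.mem_range.1 ht).le :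
            (t : ℝ) ≤ n).trans hnN
          have h1 := A.sum_integral_play_singleGoodExpert_le hΔ (by omega) hq hh t
          have h2 := one_add_pow_le_of_le_log hM hΔ0 htN
          linarith
      _ = _ := by
          simp only [Finset.sum_const, Finset.card_range, Finset.card_univ, Fintype.card_fin,
            nsmul_eq_mul]
          ring
  obtain ⟨k, -, hk⟩ := Finset.exists_le_of_sum_le
    ⟨(⟨0, by omega⟩ : Fin M), Finset.mem_univ _⟩ hsum
  refine ⟨singleGoodExpert q h k, k, fun t i hi => (hgap k t i hi).ge, fun t => ?_, ?_⟩
  · have : Nontrivial (Fin M) := Fin.nontrivial_iff_two_le.2 (by omega)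
    obtain ⟨i, hi⟩ := exists_ne k
    exact ⟨i, hi, hgap k t i hi⟩
  · rw [A.pseudoRegret_singleGoodExpert hqh]
    calc Real.log M / (256 * Δ) = Δ * (N / 16) := by rw [hN]; field_simp; norm_num
      -- `n / 8 ≥ N / 16` because `N ≤ 2n`.
      _ ≤ Δ * (n - 7 / 8 * n) := by gcongr; linarith
      _ ≤ Δ * (n - ∑ t ∈ Finset.range n, a k t) := by gcongr
      _ = ∑ t ∈ Finset.range n, Δ * (1 - a k t) := by
          rw [← Finset.mul_sum, Finset.sum_sub_distrib]; simp
      -- Rounds after `n` only add nonnegative regret.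
      _ ≤ ∑ t ∈ Finset.range T, Δ * (1 - a k t) :=
          Finset.sum_le_sum_of_subset_of_nonneg (Finset.range_subset_range.2 hnT)
            fun t _ _ => mul_nonneg hΔ0.le (sub_nonneg.2 (ha1 k t))
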